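/- Let $\mathcal H$ be a complex Hilbert space and let $A$ be a non-zero positive bounded operator on $\mathcal H$. Put $\langle x,y\rangle_A=\langle Ax,y\rangle$ and $\|x\|_A=\sqrt{\langle x,x\rangle_A}$. Let $\mathcal B_A(\mathcal H)$ be the set of bounded operators $T$ on $\mathcal H$ for which there is a bounded operator $W$ with $\langle Tx,y\rangle_A=\langle x,Wy\rangle_A$ for all $x,y\in\mathcal H$. For $T\in\mathcal B_A(\mathcal H)$ let $T^{\sharp_A}$ be the unique bounded operator $X$ with $AX=T^*A$ and $\mathcal R(X)\subseteq\overline{\mathcal R(A)}$, where $\mathcal R$ denotes the range, and put $\Re_A(T)=\frac12(T+T^{\sharp_A})$. For a bounded operator $T$ let $$\|T\|_A=\sup\{\|Tx\|_A : \|x\|_A=1\},\qquad \omega_A(T)=\sup\{|\langle Tx,x\rangle_A| : \|x\|_A=1\}.$$ Then for all $T,S\in\mathcal B_A(\mathcal H)$ the quantities $\omega_A(T)$, $\omega_A(S)$, $\omega_A(T+S)$ and $\sup_{\theta\in\mathbb R}\|\Re_A(e^{i\theta}T)\Re_A(e^{i\theta}S)\|_A$ are finite, and $$\omega_A(T+S)\le\frac12\left[\omega_A(T)+\omega_A(S)+\sqrt{\big(\omega_A(T)-\omega_A(S)\big)^2+4\sup_{\theta\in\mathbb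 R}\big\|\Re_A(e^{i\theta}T)\,\Re_A(e^{i\theta}S)\big\|_A}\,\right]\le\omega_A(T)+\omega_A(S).$$ -/

import Mathlib

open scoped ENNReal

noncomputable section

namespace SemiHilbert

variable {H : Type*} [NormedAddCommGroup H] [InnerProductSpace ℂ H] [CompleteSpace H]

/-- The semi-inner product `⟨x, y⟩_A = ⟨A x, y⟩`, linear in `x` and conjugate-linear in `y`
(Mathlib's inner product is conjugate-linear in its first argument, hence the swap). -/
def aInner (A : H →L[ℂ] H) (x y : H) : ℂ := inner ℂ y (A x)

/-- The seminorm `‖x‖_A = √⟨x, x⟩_A`. -/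
def aNorm (A : H →L[ℂ] H) (x : H) : ℝ := √(aInner A x x).re

/-- `W` is an `A`-adjoint of `T`: `⟨T x, y⟩_A = ⟨x, W y⟩_A` for all `x`, `y`. -/
def IsAAdjoint (A T W : H →L[ℂ] H) : Prop :=
  ∀ x y : H, aInner A (T x) y = aInner A x (W y)

/-- `B_A(H)`: the bounded operators admitting an `A`-adjoint. -/
def operatorsWithAAdjoint (A : H →L[ℂ] H) : Set (H →L[ℂ] H) :=
  {T | ∃ W : H →L[ℂ] H, IsAAdjoint A T W}

/-- `X` is the reduced solution of `A X = T* A`: it solves the equation and its range lies in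
the closure of the range of `A`. -/
def IsReducedSolution (A T X : H →L[ℂ] H) : Prop :=
  A ∘L X = ContinuousLinearMap.adjoint T ∘L A ∧ Set.range X ⊆ closure (Set.range A)

open Classical in
/-- The distinguished `A`-adjoint `T^♯_A`: the reduced solution of `A X = T* A`. It exists and is
unique for `T ∈ B_A(H)` with `A` positive (see `existsUnique_isReducedSolution`); the value `0` is
used otherwise. -/
def sharp (A T : H →L[ℂ] H) : H →L[ℂ] H :=
  if h : ∃ X : H →L[ℂ] H, IsReducedSolution A T X then h.choose else 0

/-- `Re_A(T) = (T + T^♯_A) / 2`. -/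
def reA (A T : H →L[ℂ] H) : H →L[ℂ] H := (1 / 2 : ℂ) • (T + sharp A T)

/-- The `A`-operator seminorm `‖T‖_A = sup {‖T x‖_A : ‖x‖_A = 1}`, with value `∞` allowed. -/
def aOpNorm (A T : H →L[ℂ] H) : ℝ≥0∞ :=
  ⨆ (x : H) (_ : aNorm A x = 1), ENNReal.ofReal (aNorm A (T x))

/-- The `A`-numerical radius `ω_A(T) = sup {|⟨T x, x⟩_A| : ‖x‖_A = 1}`, with value `∞` allowed. -/
def aNumRadius (A T : H →L[ℂ] H) : ℝ≥0∞ :=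
  ⨆ (x : H) (_ : aNorm A x = 1), ENNReal.ofReal ‖aInner A (T x) x‖

/-- `sup_{θ ∈ ℝ} ‖Re_A(e^{iθ} T) Re_A(e^{iθ} S)‖_A`, with value `∞` allowed. -/
def supReProd (A T S : H →L[ℂ] H) : ℝ≥0∞ :=
  ⨆ θ : ℝ, aOpNorm A
    (reA A (Complex.exp (Complex.I * θ) • T) ∘L reA A (Complex.exp (Complex.I * θ) • S))

theorem isAAdjoint_iff {A : H →L[ℂ] H} (hA : A.IsPositive) (T W : H →L[ℂ] H) :
    IsAAdjoint A T W ↔ A ∘L W = ContinuousLinearMap.adjoint T ∘L A := by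
  have hs : ContinuousLinearMap.adjoint A = A := hA.isSelfAdjoint.adjoint_eq
  have key : ∀ x y : H, aInner A x (W y) = inner ℂ (A (W y)) x := by
    intro x y
    rw [aInner, ← ContinuousLinearMap.adjoint_inner_left, hs]
  have key2 : ∀ x y : H, aInner A (T x) y = inner ℂ (ContinuousLinearMap.adjoint T (A y)) x := by
    intro x y
    rw [aInner, ContinuousLinearMap.adjoint_inner_left, ← ContinuousLinearMap.adjoint_inner_left A,
      hs]
  constructor
  · intro h
    ext y
    refine ext_inner_right ℂ fun x => ?_
    have := h x y
    rw [key, key2] at this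
    exact this.symm
  · intro h x y
    rw [key, key2]
    have := DFunLike.congr_fun h y
    simp only [ContinuousLinearMap.comp_apply] at this
    rw [this]

/-- For positive `A` and `T ∈ B_A(H)` the reduced solution exists and is unique. -/
theorem existsUnique_isReducedSolution {A T : H →L[ℂ] H} (hA : A.IsPositive)
    (hT : T ∈ operatorsWithAAdjoint A) : ∃! X : H →L[ℂ] H, IsReducedSolution A T X := by
  have hs : ContinuousLinearMap.adjoint A = A := hA.isSelfAdjoint.adjoint_eq
  set K : Submodule ℂ H := A.range.topologicalClosure with hK
  have hKc : (K : Set H) = closure (Set.range A) := by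
    rw [hK, Submodule.topologicalClosure_coe]
    rfl
  have hKcl : IsClosed (K : Set H) := Submodule.isClosed_topologicalClosure _
  have : CompleteSpace K := hKcl.completeSpace_coe
  have hker : Kᗮ = A.ker := by
    rw [hK, Submodule.orthogonal_closure, ContinuousLinearMap.orthogonal_range, hs]
  obtain ⟨W, hW⟩ := hT
  rw [isAAdjoint_iff hA] at hW
  refine ⟨K.starProjection ∘L W, ⟨?_, ?_⟩, ?_⟩
  · rw [← hW]
    ext y
    have h1 : W y - K.starProjection (W y) ∈ A.ker := by
      rw [← hker]
      exact K.sub_starProjection_mem_orthogonal (W y)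
    have h2 : A (W y - K.starProjection (W y)) = 0 := h1
    rw [map_sub, sub_eq_zero] at h2
    simpa using h2.symm
  · rintro _ ⟨y, rfl⟩
    rw [← hKc]
    exact K.starProjection_apply_mem (W y)
  · rintro Y ⟨hY, hYr⟩
    ext y
    have h1 : A (Y y) = A (W y) := by
      have := DFunLike.congr_fun (hY.trans hW.symm) y
      simpa using this
    have h2 : W y - Y y ∈ Kᗮ := by
      rw [hker]
      change A (W y - Y y) = 0
      rw [map_sub, h1, sub_self]
    have h3 : Y y ∈ K := by
      change Y y ∈ (K : Set H)
      rw [hKc]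
      exact hYr ⟨y, rfl⟩
    exact (Submodule.eq_starProjection_of_mem_orthogonal h3 h2).symm

theorem sharp_spec {A T : H →L[ℂ] H} (hA : A.IsPositive)
    (hT : T ∈ operatorsWithAAdjoint A) : IsReducedSolution A T (sharp A T) := by
  have h := (existsUnique_isReducedSolution hA hT).exists
  rw [sharp, dif_pos h]
  exact h.choose_spec

end SemiHilbert

end

open SemiHilbert

/-! For `A`-selfadjoint `B`, `C` with seminorms at most `b`, `c` and `‖BC‖_A ≤ m`, let `N` be the
`A`-numerical radius of `D = B + C`. Since `N` also bounds the `A`-seminorm of `D`, some `l = ±N` is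
an approximate eigenvalue: `D x ≈ l x` with `‖x‖_A = 1`. Then `(l - B)(l - C) x = l (l x - D x) + B
C x ≈ B C x`, which gives `(N - b)(N - c) ≤ m` when `N` exceeds `b` and `c`. Hence `N` is at most
the larger root of `(μ - b)(μ - c) = m` (`sub_mul_sub_le_of_approx`, `norm_aInner_add_le`).

For general `T`, `S`, a rotation `e^{iθ}` makes `⟨(T + S) x, x⟩_A` real and nonnegative, so only the
`A`-real parts of `e^{iθ} T` and `e^{iθ} S` matter. Their seminorms are at most `ω_A(T)` and
`ω_A(S)`. This also gives `m ≤ ω_A(T) ω_A(S)`, hence the second inequality. -/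

namespace SemiHilbert

section

variable {H : Type*} [NormedAddCommGroup H] [InnerProductSpace ℂ H]
  {A : H →L[ℂ] H}

/-! ### Algebra of the semi-inner product and of `A`-adjoints -/

theorem aNorm_eq_of_aInner_eq {R : H →L[ℂ] H} (hR : ∀ x y, aInner A x y = inner ℂ (R y) (R x))
    (x : H) : aNorm A x = ‖R x‖ := by
  rw [aNorm, hR, norm_eq_sqrt_re_inner (𝕜 := ℂ)]
  rfl

theorem aNorm_nonneg (x : H) : 0 ≤ aNorm A x := Real.sqrt_nonneg _

theorem aInner_add_left (x y z : H) : aInner A (x + y) z = aInner A x z + aInner A y z := by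
  simp [aInner]

theorem aInner_add_right (x y z : H) : aInner A x (y + z) = aInner A x y + aInner A x z := by
  simp [aInner]

theorem aInner_sub_left (x y z : H) : aInner A (x - y) z = aInner A x z - aInner A y z := by
  simp [aInner]

theorem aInner_sub_right (x y z : H) : aInner A x (y - z) = aInner A x y - aInner A x z := by
  simp [aInner]

theorem aInner_smul_left (c : ℂ) (x y : H) : aInner A (c • x) y = c * aInner A x y := by
  simp [aInner]

theorem aInner_smul_right (c : ℂ) (x y : H) :
    aInner A x (c • y) = (starRingEnd ℂ) c * aInner A x y := by
  simp [aInner, mul_comm]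

/-- The constant disappears on taking `2^n`-th roots: if `a > b > 0`, then `(a / b)^(2^n)` is
unbounded. -/
theorem le_of_forall_pow_two_pow_le {a b C : ℝ} (hb : 0 ≤ b)
    (h : ∀ n : ℕ, a ^ 2 ^ n ≤ C * b ^ 2 ^ n) : a ≤ b := by
  by_contra! hab
  rcases hb.eq_or_lt with rfl | hb
  · have := h 0
    simp at this
    linarith
  · have h1 : 1 < a / b := (one_lt_div hb).2 hab
    have h2 : Filter.Tendsto (fun n : ℕ => (a / b) ^ 2 ^ n) Filter.atTop Filter.atTop :=
      (tendsto_pow_atTop_atTop_of_one_lt h1).comp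
        (tendsto_pow_atTop_atTop_of_one_lt one_lt_two)
    obtain ⟨n, hn⟩ := (h2.eventually (Filter.eventually_gt_atTop C)).exists
    rw [div_pow, lt_div_iff₀ (by positivity)] at hn
    exact absurd (h n) (not_le.2 hn)

theorem IsAAdjoint.pow_self {P : H →L[ℂ] H} (hP : IsAAdjoint A P P) (n : ℕ) :
    IsAAdjoint A (P ^ n) (P ^ n) := by
  induction n with
  | zero => intro x y; simp
  | succ n ih =>
    intro x y
    rw [pow_succ, mul_apply_eq_comp, ih, hP, ← mul_apply_eq_comp,
      ← pow_succ', pow_succ]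

theorem IsAAdjoint.add {T W S V : H →L[ℂ] H} (hT : IsAAdjoint A T W) (hS : IsAAdjoint A S V) :
    IsAAdjoint A (T + S) (W + V) := by
  intro x y
  simp only [add_apply, aInner_add_left, aInner_add_right, hT x y, hS x y]

theorem IsAAdjoint.smul {T W : H →L[ℂ] H} (hT : IsAAdjoint A T W) (c : ℂ) :
    IsAAdjoint A (c • T) ((starRingEnd ℂ) c • W) := by
  intro x y
  simp [aInner_smul_left, aInner_smul_right, hT x y]

theorem smul_mem_operatorsWithAAdjoint {T : H →L[ℂ] H} (hT : T ∈ operatorsWithAAdjoint A)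
    (c : ℂ) : c • T ∈ operatorsWithAAdjoint A :=
  let ⟨_, hW⟩ := hT
  ⟨_, hW.smul c⟩

theorem add_mem_operatorsWithAAdjoint {T S : H →L[ℂ] H} (hT : T ∈ operatorsWithAAdjoint A)
    (hS : S ∈ operatorsWithAAdjoint A) : T + S ∈ operatorsWithAAdjoint A :=
  let ⟨_, hW⟩ := hT
  let ⟨_, hV⟩ := hS
  ⟨_, hW.add hV⟩

theorem aNumRadius_le_ofReal {T : H →L[ℂ] H} {r : ℝ}
    (h : ∀ x, aNorm A x = 1 → ‖aInner A (T x) x‖ ≤ r) : aNumRadius A T ≤ ENNReal.ofReal r :=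
  iSup₂_le fun x hx => ENNReal.ofReal_le_ofReal (h x hx)

theorem norm_exp_I_mul (θ : ℝ) : ‖Complex.exp (Complex.I * θ)‖ = 1 := by
  rw [mul_comm]
  exact Complex.norm_exp_ofReal_mul_I θ

theorem exists_exp_I_mul_eq_norm (z : ℂ) :
    ∃ θ : ℝ, Complex.exp (Complex.I * θ) * z = ‖z‖ := by
  refine ⟨-z.arg, ?_⟩
  nth_rw 2 [← Complex.norm_mul_exp_arg_mul_I z]
  rw [mul_left_comm, ← Complex.exp_add]
  push_cast
  rw [show Complex.I * -(z.arg : ℂ) + z.arg * Complex.I = 0 by ring, Complex.exp_zero, mul_one]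

/-! ### Seminorm identities through the square root of `A` -/

variable [CompleteSpace H]

/-- With `R = √A`, Cauchy–Schwarz, the triangle inequality and the parallelogram law pull back along
`R` from the Hilbert norm. -/
theorem exists_sqrt (hA : A.IsPositive) :
    ∃ R : H →L[ℂ] H, ∀ x y, aInner A x y = inner ℂ (R y) (R x) := by
  have h0 : 0 ≤ A := (ContinuousLinearMap.nonneg_iff_isPositive A).2 hA
  refine ⟨CFC.sqrt A, fun x y => ?_⟩
  have hsa : ContinuousLinearMap.adjoint (CFC.sqrt A) = CFC.sqrt A :=
    ((ContinuousLinearMap.nonneg_iff_isPositive _).1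
      (CFC.sqrt_nonneg A)).isSelfAdjoint.adjoint_eq
  have h : CFC.sqrt A * CFC.sqrt A = A := CFC.sqrt_mul_sqrt_self A h0
  rw [← ContinuousLinearMap.adjoint_inner_right, hsa, ← mul_apply_eq_comp, h, aInner]

theorem aNorm_add_le (hA : A.IsPositive) (x y : H) :
    aNorm A (x + y) ≤ aNorm A x + aNorm A y := by
  obtain ⟨R, hR⟩ := exists_sqrt hA
  simp only [aNorm_eq_of_aInner_eq hR, map_add]
  exact norm_add_le _ _

theorem aNorm_sub_le (hA : A.IsPositive) (x y : H) :
    aNorm A x - aNorm A y ≤ aNorm A (x - y) := by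
  obtain ⟨R, hR⟩ := exists_sqrt hA
  simp only [aNorm_eq_of_aInner_eq hR, map_sub]
  exact norm_sub_norm_le _ _

theorem aNorm_smul (hA : A.IsPositive) (c : ℂ) (x : H) : aNorm A (c • x) = ‖c‖ * aNorm A x := by
  obtain ⟨R, hR⟩ := exists_sqrt hA
  simp only [aNorm_eq_of_aInner_eq hR, map_smul, norm_smul]

theorem norm_aInner_le (hA : A.IsPositive) (x y : H) :
    ‖aInner A x y‖ ≤ aNorm A x * aNorm A y := by
  obtain ⟨R, hR⟩ := exists_sqrt hA
  rw [aNorm_eq_of_aInner_eq hR, aNorm_eq_of_aInner_eq hR, hR, mul_comm]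
  exact norm_inner_le_norm _ _

theorem aInner_self (hA : A.IsPositive) (x : H) : aInner A x x = (aNorm A x : ℂ) ^ 2 := by
  obtain ⟨R, hR⟩ := exists_sqrt hA
  rw [aNorm_eq_of_aInner_eq hR, hR]
  exact inner_self_eq_norm_sq_to_K _

theorem aInner_conj_symm (hA : A.IsPositive) (x y : H) :
    (starRingEnd ℂ) (aInner A x y) = aInner A y x := by
  obtain ⟨R, hR⟩ := exists_sqrt hA
  rw [hR, hR]
  exact inner_conj_symm _ _

theorem aNorm_add_sq_add_aNorm_sub_sq (hA : A.IsPositive) (x y : H) :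
    aNorm A (x + y) ^ 2 + aNorm A (x - y) ^ 2 = 2 * (aNorm A x ^ 2 + aNorm A y ^ 2) := by
  obtain ⟨R, hR⟩ := exists_sqrt hA
  simp only [aNorm_eq_of_aInner_eq hR, map_add, map_sub]
  have := parallelogram_law_with_norm ℂ (R x) (R y)
  nlinarith

theorem aNorm_sub_ofReal_smul_sq (hA : A.IsPositive) (x y : H) (t : ℝ) :
    aNorm A (y - (t : ℂ) • x) ^ 2 =
      aNorm A y ^ 2 - 2 * t * (aInner A y x).re + t ^ 2 * aNorm A x ^ 2 := by
  obtain ⟨R, hR⟩ := exists_sqrt hA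
  simp only [aNorm_eq_of_aInner_eq hR, map_sub, map_smul, hR]
  rw [norm_sub_sq (𝕜 := ℂ), norm_smul, inner_smul_right, ← inner_conj_symm]
  simp only [RCLike.re_to_complex, Complex.mul_re, Complex.ofReal_re, Complex.ofReal_im,
    Complex.conj_re, Complex.norm_real, mul_pow, Real.norm_eq_abs, sq_abs]
  ring

theorem exists_aNorm_le (hA : A.IsPositive) : ∃ C : ℝ, ∀ x, aNorm A x ≤ C * ‖x‖ := by
  obtain ⟨R, hR⟩ := exists_sqrt hA
  refine ⟨‖R‖, fun x => ?_⟩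
  rw [aNorm_eq_of_aInner_eq hR]
  exact R.le_opNorm x

/-! ### Boundedness in the `A`-seminorm -/

theorem IsAAdjoint.aNorm_sq_le (hA : A.IsPositive) {P W : H →L[ℂ] H} (hP : IsAAdjoint A P W)
    (x : H) : aNorm A (P x) ^ 2 ≤ aNorm A x * aNorm A (W (P x)) := by
  have h1 := norm_aInner_le hA x (W (P x))
  rw [← hP, aInner_self hA] at h1
  simpa using h1

/-- Iterating `‖P x‖_A² ≤ ‖P² x‖_A ‖x‖_A` bounds the `A`-seminorm by the operator norm. -/
theorem IsAAdjoint.aNorm_self_le (hA : A.IsPositive) {P : H →L[ℂ] H} (hP : IsAAdjoint A P P)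
    (x : H) : aNorm A (P x) ≤ ‖P‖ * aNorm A x := by
  have step (n : ℕ) : aNorm A ((P ^ n) x) ^ 2 ≤ aNorm A x * aNorm A ((P ^ (n * 2)) x) := by
    have := (hP.pow_self n).aNorm_sq_le hA x
    rwa [← mul_apply_eq_comp, ← pow_two, ← pow_mul] at this
  -- The extra factor `‖x‖_A` on both sides avoids the exponent `2^n - 1`.
  have iter (n : ℕ) : aNorm A (P x) ^ 2 ^ n * aNorm A x ≤
      aNorm A x ^ 2 ^ n * aNorm A ((P ^ 2 ^ n) x) := by
    induction n with
    | zero => simp [mul_comm]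
    | succ n ih =>
      have h0 := aNorm_nonneg (A := A) x
      have h1 := aNorm_nonneg (A := A) (P x)
      rcases h0.eq_or_lt with h | h
      · rw [← h]; simp
      have h2 : (aNorm A (P x) ^ 2 ^ n * aNorm A x) ^ 2 ≤
          (aNorm A x ^ 2 ^ n * aNorm A ((P ^ 2 ^ n) x)) ^ 2 := by gcongr
      have h3 := mul_le_mul_of_nonneg_left (step (2 ^ n)) (sq_nonneg (aNorm A x ^ 2 ^ n))
      refine le_of_mul_le_mul_right ?_ h
      rw [← pow_succ] at h3
      calc aNorm A (P x) ^ 2 ^ (n + 1) * aNorm A x * aNorm A x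
          = (aNorm A (P x) ^ 2 ^ n * aNorm A x) ^ 2 := by rw [pow_succ 2 n, pow_mul]; ring
        _ ≤ (aNorm A x ^ 2 ^ n) ^ 2 * (aNorm A x * aNorm A ((P ^ 2 ^ (n + 1)) x)) := by
          rw [mul_pow _ (aNorm A ((P ^ 2 ^ n) x))] at h2
          exact h2.trans h3
        _ = aNorm A x ^ 2 ^ (n + 1) * aNorm A ((P ^ 2 ^ (n + 1)) x) * aNorm A x := by
          rw [← pow_mul, ← pow_succ]; ring
  obtain ⟨C, hC⟩ := exists_aNorm_le hA
  rcases (aNorm_nonneg (A := A) x).eq_or_lt with h | h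
  -- A vector of zero seminorm is sent to one of zero seminorm, by the first step alone.
  · have := step 1
    rw [← h, zero_mul, pow_one] at this
    rw [← h, mul_zero]
    exact (pow_eq_zero_iff two_ne_zero).1 (le_antisymm this (sq_nonneg _)) |>.le
  · refine le_of_forall_pow_two_pow_le (C := |C| * ‖x‖ / aNorm A x) (by positivity) fun n => ?_
    rw [div_mul_eq_mul_div, le_div_iff₀ h]
    refine (iter n).trans ?_
    have h4 : aNorm A ((P ^ 2 ^ n) x) ≤ |C| * (‖P‖ ^ 2 ^ n * ‖x‖) := by
      refine (hC _).trans ?_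
      gcongr
      · exact le_abs_self C
      · refine ((P ^ 2 ^ n).le_opNorm x).trans ?_
        gcongr
        exact norm_pow_le' P (by positivity)
    calc _ ≤ aNorm A x ^ 2 ^ n * (|C| * (‖P‖ ^ 2 ^ n * ‖x‖)) := by gcongr
      _ = _ := by ring

theorem IsAAdjoint.symm (hA : A.IsPositive) {T W : H →L[ℂ] H} (h : IsAAdjoint A T W) :
    IsAAdjoint A W T := by
  intro x y
  rw [← aInner_conj_symm hA, ← h, aInner_conj_symm hA]

/-- `W T` is `A`-selfadjoint and `‖T x‖_A² = ⟨x, W T x⟩_A`, so the selfadjoint bound applies to `W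
T`. -/
theorem IsAAdjoint.aNorm_le (hA : A.IsPositive) {T W : H →L[ℂ] H} (h : IsAAdjoint A T W)
    (x : H) : aNorm A (T x) ≤ √‖W * T‖ * aNorm A x := by
  have hP : IsAAdjoint A (W * T) (W * T) := by
    intro x y
    rw [mul_apply_eq_comp, h.symm hA, h, mul_apply_eq_comp]
  have h1 := h.aNorm_sq_le hA x
  have h2 := hP.aNorm_self_le hA x
  rw [mul_apply_eq_comp] at h2
  refine abs_le_of_sq_le_sq' ?_ (mul_nonneg (Real.sqrt_nonneg _) (aNorm_nonneg x)) |>.2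
  rw [mul_pow, Real.sq_sqrt (norm_nonneg _)]
  nlinarith [aNorm_nonneg (A := A) x]

/-! ### Numerical range of an `A`-selfadjoint operator -/

theorem aInner_apply_self_im_eq_zero (hA : A.IsPositive) {D : H →L[ℂ] H} (hD : IsAAdjoint A D D)
    (x : H) : (aInner A (D x) x).im = 0 := by
  rw [← Complex.conj_eq_iff_im, aInner_conj_symm hA, hD]

/-- For an `A`-selfadjoint operator the `A`-operator seminorm is at most the `A`-numerical
radius. -/
theorem IsAAdjoint.aNorm_le_of_norm_aInner_le (hA : A.IsPositive) {D : H →L[ℂ] H}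
    (hD : IsAAdjoint A D D) {w : ℝ} (hw : ∀ x, ‖aInner A (D x) x‖ ≤ w * aNorm A x ^ 2) (x : H) :
    aNorm A (D x) ≤ w * aNorm A x := by
  -- Polarization: `4 Re ⟨D x, y⟩_A` is the difference of the quadratic form of `D` at `x + y` and
  -- `x - y`; the parallelogram law sums the two bounds.
  have polar (y : H) : 4 * (aInner A (D x) y).re ≤ 2 * w * (aNorm A x ^ 2 + aNorm A y ^ 2) := by
    have h1 := (Complex.re_le_norm _).trans (hw (x + y))
    have h2 := (neg_le_abs _).trans ((Complex.abs_re_le_norm _).trans (hw (x - y)))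
    have h3 := aNorm_add_sq_add_aNorm_sub_sq hA x y
    have h4 : (aInner A (D y) x).re = (aInner A (D x) y).re := by
      rw [hD, ← aInner_conj_symm hA, Complex.conj_re]
    simp only [map_add, map_sub, aInner_add_left, aInner_add_right, aInner_sub_left,
      aInner_sub_right, Complex.add_re, Complex.sub_re] at h1 h2
    have h5 : w * aNorm A (x + y) ^ 2 + w * aNorm A (x - y) ^ 2
        = 2 * w * (aNorm A x ^ 2 + aNorm A y ^ 2) := by rw [← mul_add, h3]; ring
    linarith
  rcases (aNorm_nonneg (A := A) x).eq_or_lt with h | h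
  · have := hD.aNorm_self_le hA x
    rwa [← h, mul_zero] at this ⊢
  rcases (aNorm_nonneg (A := A) (D x)).eq_or_lt with h' | h'
  · rw [← h']
    have := (norm_nonneg _).trans (hw x)
    exact mul_nonneg (nonneg_of_mul_nonneg_left this (by positivity)) h.le
  -- This `y` is `D x` rescaled to the seminorm of `x`.
  have h1 := polar (((aNorm A x / aNorm A (D x) : ℝ) : ℂ) • D x)
  have h2 : (aInner A (D x) (((aNorm A x / aNorm A (D x) : ℝ) : ℂ) • D x)).re =
      aNorm A x * aNorm A (D x) := by
    rw [aInner_smul_right, aInner_self hA, Complex.conj_ofReal, ← Complex.ofReal_pow,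
      ← Complex.ofReal_mul, Complex.ofReal_re]
    field_simp
  have h3 : aNorm A (((aNorm A x / aNorm A (D x) : ℝ) : ℂ) • D x) = aNorm A x := by
    rw [aNorm_smul hA, Complex.norm_real, Real.norm_of_nonneg (by positivity)]
    field_simp
  rw [h2, h3] at h1
  refine le_of_mul_le_mul_left ?_ h
  linarith

/-- If `D` is `A`-selfadjoint, `N` bounds its `A`-numerical range and `|⟨D x, x⟩_A|` is close to
`N`, then `x` is an approximate eigenvector for `N` or `-N`. -/
theorem exists_aNorm_sub_smul_sq_le (hA : A.IsPositive) {D : H →L[ℂ] H} (hD : IsAAdjoint A D D)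
    {N : ℝ} (hN : 0 ≤ N) (hw : ∀ x, ‖aInner A (D x) x‖ ≤ N * aNorm A x ^ 2) {x : H}
    (hx : aNorm A x = 1) {ε : ℝ} (hε : N - ε ≤ ‖aInner A (D x) x‖) :
    ∃ l : ℝ, |l| = N ∧ aNorm A (D x - (l : ℂ) • x) ^ 2 ≤ 2 * N * ε := by
  have him := aInner_apply_self_im_eq_zero hA hD x
  have hre : ‖aInner A (D x) x‖ = |(aInner A (D x) x).re| := by
    rw [Complex.abs_re_eq_norm.2 him]
  have hDx := hD.aNorm_le_of_norm_aInner_le hA hw x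
  rw [hx, mul_one] at hDx
  have hDx2 : aNorm A (D x) ^ 2 ≤ N ^ 2 := pow_le_pow_left₀ (aNorm_nonneg _) hDx 2
  rw [hre] at hε
  -- The sign of `l` is that of `⟨D x, x⟩_A`; expanding the square gives at most `N² - 2 N (N - ε) +
  -- N² = 2 N ε`.
  rcases abs_choice (aInner A (D x) x).re with h | h
  · refine ⟨N, abs_of_nonneg hN, ?_⟩
    rw [aNorm_sub_ofReal_smul_sq hA, hx]
    rw [h] at hε
    nlinarith
  · refine ⟨-N, by rw [abs_neg, abs_of_nonneg hN], ?_⟩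
    rw [aNorm_sub_ofReal_smul_sq hA, hx]
    rw [h] at hε
    nlinarith

/-! ### Sums of two `A`-selfadjoint operators -/

theorem mul_aNorm_le_aNorm_smul_sub (hA : A.IsPositive) {B : H →L[ℂ] H} {b : ℝ}
    (hb : ∀ x, aNorm A (B x) ≤ b * aNorm A x) (l : ℝ) (x : H) :
    (|l| - b) * aNorm A x ≤ aNorm A ((l : ℂ) • x - B x) := by
  have h := aNorm_sub_le hA ((l : ℂ) • x) (B x)
  rw [aNorm_smul hA, Complex.norm_real, Real.norm_eq_abs] at h
  linarith [hb x]

/-- Both factors of `(l - B)(l - C) x` are bounded below, while the product equals `l (l x - (B + C)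
x) + B C x`. The condition `b ≤ |l|` allows the two lower bounds to be multiplied. -/
theorem sub_mul_sub_le_of_approx (hA : A.IsPositive) {B C : H →L[ℂ] H} {b c m : ℝ}
    (hb : ∀ x, aNorm A (B x) ≤ b * aNorm A x) (hc : ∀ x, aNorm A (C x) ≤ c * aNorm A x)
    (hm : ∀ x, aNorm A (B (C x)) ≤ m * aNorm A x) {x : H} (hx : aNorm A x = 1) (l : ℝ)
    (hl : b ≤ |l|) :
    (|l| - b) * (|l| - c) ≤ |l| * aNorm A ((B + C) x - (l : ℂ) • x) + m := by
  have h1 := mul_aNorm_le_aNorm_smul_sub hA hb l ((l : ℂ) • x - C x)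
  have h2 := mul_aNorm_le_aNorm_smul_sub hA hc l x
  rw [hx, mul_one] at h2
  have h3 : (l : ℂ) • ((l : ℂ) • x - C x) - B ((l : ℂ) • x - C x) =
      (-(l : ℂ)) • ((B + C) x - (l : ℂ) • x) + B (C x) := by
    simp only [map_sub, map_smul, add_apply]
    module
  have h4 := aNorm_add_le hA ((-(l : ℂ)) • ((B + C) x - (l : ℂ) • x)) (B (C x))
  rw [aNorm_smul hA, norm_neg, Complex.norm_real, Real.norm_eq_abs] at h4
  have h5 := hm x
  rw [hx, mul_one] at h5
  rw [h3] at h1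
  have h6 := mul_le_mul_of_nonneg_left h2 (sub_nonneg.2 hl)
  linarith

theorem norm_aInner_apply_self_le_of_forall_unit (hA : A.IsPositive) {T : H →L[ℂ] H}
    {w : ℝ} (h : ∀ x, aNorm A x = 1 → ‖aInner A (T x) x‖ ≤ w) (x : H) :
    ‖aInner A (T x) x‖ ≤ w * aNorm A x ^ 2 := by
  rcases (aNorm_nonneg (A := A) x).eq_or_lt with h0 | h0
  · have := norm_aInner_le hA (T x) x
    rw [← h0, mul_zero] at this
    rw [← h0]
    simpa using this
  · have h1 := h ((((aNorm A x)⁻¹ : ℝ) : ℂ) • x)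
    rw [aNorm_smul hA, Complex.norm_real,
      Real.norm_of_nonneg (by positivity), map_smul, aInner_smul_left, aInner_smul_right,
      norm_mul, norm_mul, RCLike.norm_conj, Complex.norm_real,
      Real.norm_of_nonneg (by positivity)] at h1
    have h2 := h1 (by field_simp)
    field_simp at h2
    rwa [mul_comm] at h2

/-- Vectors of zero seminorm cannot be normalized; the `A`-adjoint guarantees that their images also
have zero seminorm. -/
theorem aNorm_apply_le_of_forall_unit (hA : A.IsPositive) {T W : H →L[ℂ] H}
    (hT : IsAAdjoint A T W) {w : ℝ} (h : ∀ x, aNorm A x = 1 → aNorm A (T x) ≤ w) (x : H) :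
    aNorm A (T x) ≤ w * aNorm A x := by
  rcases (aNorm_nonneg (A := A) x).eq_or_lt with h0 | h0
  · have := hT.aNorm_le hA x
    rw [← h0, mul_zero] at this
    rw [← h0]
    simpa using this
  · have h1 := h ((((aNorm A x)⁻¹ : ℝ) : ℂ) • x)
    rw [aNorm_smul hA, Complex.norm_real, Real.norm_of_nonneg (by positivity), map_smul,
      aNorm_smul hA, Complex.norm_real, Real.norm_of_nonneg (by positivity)] at h1
    have h2 := h1 (by field_simp)
    field_simp at h2
    rwa [mul_comm] at h2

/-- Norm inequality for the sum of two `A`-selfadjoint operators. -/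
theorem norm_aInner_add_le (hA : A.IsPositive) {B C : H →L[ℂ] H} {b c m μ : ℝ}
    (hB : IsAAdjoint A B B) (hC : IsAAdjoint A C C)
    (hb : ∀ x, aNorm A (B x) ≤ b * aNorm A x) (hc : ∀ x, aNorm A (C x) ≤ c * aNorm A x)
    (hm : ∀ x, aNorm A (B (C x)) ≤ m * aNorm A x) (hμ0 : 0 ≤ μ) (hbμ : b ≤ μ) (hcμ : c ≤ μ)
    (hμ : m ≤ (μ - b) * (μ - c)) {x : H} (hx : aNorm A x = 1) :
    ‖aInner A ((B + C) x) x‖ ≤ μ := by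
  set s : Set ℝ := {r | ∃ x, aNorm A x = 1 ∧ r = ‖aInner A ((B + C) x) x‖} with hs
  have hbdd : BddAbove s := by
    refine ⟨b + c, ?_⟩
    rintro _ ⟨y, hy, rfl⟩
    have h1 := norm_aInner_le hA ((B + C) y) y
    have h2 := aNorm_add_le hA (B y) (C y)
    have h3 := hb y
    have h4 := hc y
    rw [hy, mul_one] at h1 h3 h4
    rw [add_apply] at h1 ⊢
    linarith
  set N : ℝ := sSup s with hN
  have hle : ∀ y, aNorm A y = 1 → ‖aInner A ((B + C) y) y‖ ≤ N := fun y hy =>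
    le_csSup hbdd ⟨y, hy, rfl⟩
  refine (hle x hx).trans ?_
  by_contra! hlt
  have hNpos : 0 < N := hμ0.trans_lt hlt
  have hD := hB.add hC
  have hw := norm_aInner_apply_self_le_of_forall_unit hA hle
  have key : (N - b) * (N - c) ≤ m := by
    refine le_of_forall_pos_le_add fun δ hδ => ?_
    -- The tolerance `ε = (δ / N)² / (2 N)` makes `2 N ε = (δ / N)²`, so the final error `N · (δ /
    -- N)` is exactly `δ`.
    obtain ⟨_, ⟨y, hy, rfl⟩, hyN⟩ := exists_lt_of_lt_csSup (s := s) ⟨_, x, hx, rfl⟩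
      (show N - (δ / N) ^ 2 / (2 * N) < N from sub_lt_self _ (by positivity))
    obtain ⟨l, hl, hly⟩ := exists_aNorm_sub_smul_sq_le hA hD hNpos.le hw hy hyN.le
    have h1 : aNorm A ((B + C) y - (l : ℂ) • y) ≤ δ / N := by
      refine (abs_le_of_sq_le_sq' (hly.trans_eq ?_) (by positivity)).2
      field_simp
    have h2 := sub_mul_sub_le_of_approx hA hb hc hm hy l (by rw [hl]; linarith)
    rw [hl] at h2
    have h3 : N * (δ / N) = δ := by field_simp
    nlinarith [mul_le_mul_of_nonneg_left h1 hNpos.le]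
  -- As `N > μ ≥ b, c`, the product `(N - b)(N - c)` strictly exceeds `(μ - b)(μ - c) ≥ m`.
  nlinarith

/-! ### `A`-real parts, rotations and finiteness -/

theorem isAAdjoint_sharp (hA : A.IsPositive) {T : H →L[ℂ] H}
    (hT : T ∈ operatorsWithAAdjoint A) : IsAAdjoint A T (sharp A T) :=
  (isAAdjoint_iff hA _ _).2 (sharp_spec hA hT).1

theorem isAAdjoint_reA (hA : A.IsPositive) {T : H →L[ℂ] H}
    (hT : T ∈ operatorsWithAAdjoint A) : IsAAdjoint A (reA A T) (reA A T) := by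
  have h := isAAdjoint_sharp hA hT
  have h1 := (h.add (h.symm hA)).smul (1 / 2)
  have h2 : (starRingEnd ℂ) (1 / 2 : ℂ) = 1 / 2 := by
    rw [← Complex.ofReal_ofNat, ← Complex.ofReal_one, ← Complex.ofReal_div, Complex.conj_ofReal]
  rwa [h2, add_comm (sharp A T) T] at h1

theorem aInner_reA_apply_self (hA : A.IsPositive) {T : H →L[ℂ] H}
    (hT : T ∈ operatorsWithAAdjoint A) (x : H) :
    aInner A (reA A T x) x = ((aInner A (T x) x).re : ℂ) := by
  have h := isAAdjoint_sharp hA hT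
  have h1 : aInner A (sharp A T x) x = (starRingEnd ℂ) (aInner A (T x) x) := by
    rw [h, aInner_conj_symm hA]
  rw [reA, smul_apply, add_apply, aInner_smul_left,
    aInner_add_left, h1, Complex.add_conj]
  push_cast
  ring

theorem aNumRadius_ne_top (hA : A.IsPositive) {T : H →L[ℂ] H}
    (hT : T ∈ operatorsWithAAdjoint A) : aNumRadius A T ≠ ⊤ := by
  obtain ⟨W, hW⟩ := hT
  refine ((aNumRadius_le_ofReal (r := √‖W * T‖) fun x hx => ?_).trans_lt
    ENNReal.ofReal_lt_top).ne
  have h1 := norm_aInner_le hA (T x) x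
  have h2 := hW.aNorm_le hA x
  rw [hx, mul_one] at h1 h2
  exact h1.trans h2

theorem norm_aInner_le_aNumRadius (hA : A.IsPositive) {T : H →L[ℂ] H}
    (hT : T ∈ operatorsWithAAdjoint A) (x : H) :
    ‖aInner A (T x) x‖ ≤ (aNumRadius A T).toReal * aNorm A x ^ 2 := by
  refine norm_aInner_apply_self_le_of_forall_unit hA (fun y hy => ?_) x
  rw [← ENNReal.ofReal_le_iff_le_toReal (aNumRadius_ne_top hA hT)]
  exact le_iSup₂ (f := fun (x : H) (_ : aNorm A x = 1) => ENNReal.ofReal ‖aInner A (T x) x‖) y hy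

/-- The quadratic form of the `A`-real part is `Re (e^{iθ} ⟨T x, x⟩_A)`, bounded by `ω_A(T) ‖x‖_A²`;
for an `A`-selfadjoint operator this bounds the seminorm too. -/
theorem aNorm_reA_rotation_le (hA : A.IsPositive) {T : H →L[ℂ] H}
    (hT : T ∈ operatorsWithAAdjoint A) (θ : ℝ) (x : H) :
    aNorm A (reA A (Complex.exp (Complex.I * θ) • T) x) ≤
      (aNumRadius A T).toReal * aNorm A x := by
  have hT' := smul_mem_operatorsWithAAdjoint hT (Complex.exp (Complex.I * θ))
  refine (isAAdjoint_reA hA hT').aNorm_le_of_norm_aInner_le hA (fun y => ?_) x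
  rw [aInner_reA_apply_self hA hT', Complex.norm_real, Real.norm_eq_abs]
  refine (Complex.abs_re_le_norm _).trans ?_
  rw [smul_apply, aInner_smul_left, norm_mul, norm_exp_I_mul, one_mul]
  exact norm_aInner_le_aNumRadius hA hT y

theorem supReProd_le (hA : A.IsPositive) {T S : H →L[ℂ] H}
    (hT : T ∈ operatorsWithAAdjoint A) (hS : S ∈ operatorsWithAAdjoint A) :
    supReProd A T S ≤ ENNReal.ofReal ((aNumRadius A T).toReal * (aNumRadius A S).toReal) := by
  refine iSup_le fun θ => iSup₂_le fun x hx => ENNReal.ofReal_le_ofReal ?_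
  refine (aNorm_reA_rotation_le hA hT θ _).trans ?_
  gcongr
  simpa [hx] using aNorm_reA_rotation_le hA hS θ x

theorem supReProd_ne_top (hA : A.IsPositive) {T S : H →L[ℂ] H}
    (hT : T ∈ operatorsWithAAdjoint A) (hS : S ∈ operatorsWithAAdjoint A) :
    supReProd A T S ≠ ⊤ :=
  ((supReProd_le hA hT hS).trans_lt ENNReal.ofReal_lt_top).ne

theorem aNorm_reA_mul_reA_le (hA : A.IsPositive) {T S : H →L[ℂ] H}
    (hT : T ∈ operatorsWithAAdjoint A) (hS : S ∈ operatorsWithAAdjoint A) (θ : ℝ) (x : H) :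
    aNorm A (reA A (Complex.exp (Complex.I * θ) • T) (reA A (Complex.exp (Complex.I * θ) • S) x))
      ≤ (supReProd A T S).toReal * aNorm A x := by
  have hT' := isAAdjoint_reA hA (smul_mem_operatorsWithAAdjoint hT (Complex.exp (Complex.I * θ)))
  have hS' := isAAdjoint_reA hA (smul_mem_operatorsWithAAdjoint hS (Complex.exp (Complex.I * θ)))
  set B := reA A (Complex.exp (Complex.I * θ) • T) with hB
  set C := reA A (Complex.exp (Complex.I * θ) • S) with hC
  -- The product need not be `A`-selfadjoint, but having an `A`-adjoint suffices to extend the bound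
  -- from unit vectors.
  have hBC : IsAAdjoint A (B ∘L C) (C ∘L B) := by
    intro x y
    rw [ContinuousLinearMap.comp_apply, hT', hS', ContinuousLinearMap.comp_apply]
  refine aNorm_apply_le_of_forall_unit hA hBC (fun y hy => ?_) x
  rw [← ENNReal.ofReal_le_iff_le_toReal (supReProd_ne_top hA hT hS)]
  exact (le_iSup₂ (f := fun (x : H) (_ : aNorm A x = 1) =>
    ENNReal.ofReal (aNorm A ((B ∘L C) x))) y hy).trans
    (le_iSup (fun θ : ℝ => aOpNorm A (reA A (Complex.exp (Complex.I * θ) • T) ∘L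
      reA A (Complex.exp (Complex.I * θ) • S))) θ)

theorem norm_aInner_add_apply_self_le (hA : A.IsPositive) {T S : H →L[ℂ] H}
    (hT : T ∈ operatorsWithAAdjoint A) (hS : S ∈ operatorsWithAAdjoint A) {μ : ℝ}
    (hTμ : (aNumRadius A T).toReal ≤ μ) (hSμ : (aNumRadius A S).toReal ≤ μ)
    (hμ : (supReProd A T S).toReal ≤
      (μ - (aNumRadius A T).toReal) * (μ - (aNumRadius A S).toReal))
    {x : H} (hx : aNorm A x = 1) : ‖aInner A ((T + S) x) x‖ ≤ μ := by
  -- For this `θ`, the form of the sum of the two real parts at `x` equals `|⟨(T + S) x, x⟩_A|`.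
  obtain ⟨θ, hθ⟩ := exists_exp_I_mul_eq_norm (aInner A ((T + S) x) x)
  have hT' := smul_mem_operatorsWithAAdjoint hT (Complex.exp (Complex.I * θ))
  have hS' := smul_mem_operatorsWithAAdjoint hS (Complex.exp (Complex.I * θ))
  have h := norm_aInner_add_le hA (isAAdjoint_reA hA hT') (isAAdjoint_reA hA hS')
    (aNorm_reA_rotation_le hA hT θ) (aNorm_reA_rotation_le hA hS θ)
    (aNorm_reA_mul_reA_le hA hT hS θ) (ENNReal.toReal_nonneg.trans hTμ) hTμ hSμ hμ hx
  rw [add_apply, aInner_add_left, aInner_reA_apply_self hA hT',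
    aInner_reA_apply_self hA hS', ← Complex.ofReal_add, ← Complex.add_re, ← aInner_add_left,
    smul_apply, smul_apply, ← smul_add,
    ← add_apply, aInner_smul_left, hθ, Complex.ofReal_re,
    Complex.norm_real, norm_norm] at h
  exact h

end

end SemiHilbert

theorem theorem3p4 {H : Type*} [NormedAddCommGroup H] [InnerProductSpace ℂ H] [CompleteSpace H]
    (A : H →L[ℂ] H) (hA : A.IsPositive) (hA0 : A ≠ 0)
    (T S : H →L[ℂ] H) (hT : T ∈ operatorsWithAAdjoint A) (hS : S ∈ operatorsWithAAdjoint A) :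
    -- all the suprema are finite, so that the real values below are the genuine ones
    (aNumRadius A T ≠ ⊤ ∧ aNumRadius A S ≠ ⊤ ∧ aNumRadius A (T + S) ≠ ⊤ ∧
      supReProd A T S ≠ ⊤) ∧
    (aNumRadius A (T + S)).toReal ≤
      (1 / 2 : ℝ) * ((aNumRadius A T).toReal + (aNumRadius A S).toReal +
        √(((aNumRadius A T).toReal - (aNumRadius A S).toReal) ^ 2 +
          4 * (supReProd A T S).toReal)) ∧
      (1 / 2 : ℝ) * ((aNumRadius A T).toReal + (aNumRadius A S).toReal +
        √(((aNumRadius A T).toReal - (aNumRadius A S).toReal) ^ 2 +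
          4 * (supReProd A T S).toReal)) ≤
      (aNumRadius A T).toReal + (aNumRadius A S).toReal := by 
  have hw := aNumRadius_ne_top hA (add_mem_operatorsWithAAdjoint hT hS)
  refine ⟨⟨aNumRadius_ne_top hA hT, aNumRadius_ne_top hA hS, hw, supReProd_ne_top hA hT hS⟩, ?_⟩
  have hm : (supReProd A T S).toReal ≤ (aNumRadius A T).toReal * (aNumRadius A S).toReal :=
    ENNReal.toReal_le_of_le_ofReal (by positivity) (supReProd_le hA hT hS)
  have hm0 : 0 ≤ (supReProd A T S).toReal := ENNReal.toReal_nonneg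
  have ha0 : 0 ≤ (aNumRadius A T).toReal := ENNReal.toReal_nonneg
  have hb0 : 0 ≤ (aNumRadius A S).toReal := ENNReal.toReal_nonneg
  have hsum : ∀ μ : ℝ, (aNumRadius A T).toReal ≤ μ → (aNumRadius A S).toReal ≤ μ →
      (supReProd A T S).toReal ≤
        (μ - (aNumRadius A T).toReal) * (μ - (aNumRadius A S).toReal) →
      (aNumRadius A (T + S)).toReal ≤ μ := fun μ h1 h2 h3 =>
    ENNReal.toReal_le_of_le_ofReal (ha0.trans h1) (aNumRadius_le_ofReal fun x hx =>
      norm_aInner_add_apply_self_le hA hT hS h1 h2 h3 hx)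
  generalize (aNumRadius A T).toReal = a at *
  generalize (aNumRadius A S).toReal = b at *
  generalize (supReProd A T S).toReal = m at *
  -- The middle quantity is the larger root `μ` of `(μ - a)(μ - b) = m`; this bound gives `μ ≥ a`
  -- and `μ ≥ b`.
  have hr : |a - b| ≤ √((a - b) ^ 2 + 4 * m) := Real.abs_le_sqrt (by linarith)
  have hr2 : √((a - b) ^ 2 + 4 * m) ^ 2 = (a - b) ^ 2 + 4 * m := Real.sq_sqrt (by positivity)
  have hr3 := abs_le.1 hr
  constructor
  · refine hsum _ (by linarith) (by linarith) ?_
    nlinarith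
  -- From `m ≤ a b`, the radicand is at most `(a - b)² + 4 a b = (a + b)²`.
  · have : √((a - b) ^ 2 + 4 * m) ≤ a + b := Real.sqrt_le_iff.2 ⟨by positivity, by nlinarith⟩
    linarith
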